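/- Let $X$ be a real Hilbert space (finite- or infinite-dimensional) with inner product $\langle\cdot,\cdot\rangle$. A closed halfspace is a set $\{x\in X : \langle a,x\rangle\le\beta\}$ with $a\in X\setminus\{0\}$ and $\beta\in\mathbb{R}$; a polyhedral set is the intersection of finitely many closed halfspaces (the empty intersection being $X$). For a nonempty closed convex set $C\subseteq X$, let $P_C$ denote the map sending each $x\in X$ to its unique nearest point in $C$. Let $\mathcal{C}$ be a nonempty finite collection of nonempty polyhedral subsets of $X$, let $\lambda\in[0,2)$ and $x_0\in X$. Let $(x_n)_{n\in\mathbb{N}}$ be any sequence in $X$ starting at $x_0$ such that for every $n\in\mathbb{N}$ there are $C_n\in\mathcal{C}$ and $\mu_n\in[0,\lambda]$ with $$x_{n+1}=(1-\mu_n)x_n+\mu_n P_{C_n}x_n.$$ Then the sequence $(x_n)_{n\in\mathbb{N}}$ is bounded. -/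

import Mathlib

namespace RelaxedProjections

variable {X : Type*} [NormedAddCommGroup X] [InnerProductSpace ℝ X]

/-- A closed halfspace of `X`: a set `{x | ⟪a, x⟫ ≤ β}` with `a ≠ 0` and `β` real. -/
def IsClosedHalfspace (H : Set X) : Prop :=
  ∃ a : X, a ≠ 0 ∧ ∃ β : ℝ, H = {x : X | inner ℝ a x ≤ β}

/-- A polyhedral set: the intersection of finitely many closed halfspaces
(the empty intersection being the whole space). -/
def IsPolyhedral (C : Set X) : Prop :=
  ∃ S : Set (Set X), S.Finite ∧ (∀ H ∈ S, IsClosedHalfspace H) ∧ C = ⋂₀ S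

/-- `p` is a nearest point of `C` to `x`. -/
def IsNearestPoint (C : Set X) (x p : X) : Prop :=
  p ∈ C ∧ ∀ y ∈ C, ‖x - p‖ ≤ ‖x - y‖

/-- The projector `P_C`: it maps `x` to its nearest point in `C`. The nearest point exists and is
unique when `C` is a nonempty closed convex subset of a Hilbert space, see
`existsUnique_isNearestPoint` and `projector_eq_iff`. -/
noncomputable def projector (C : Set X) (x : X) : X :=
  Classical.epsilon fun p : X => IsNearestPoint C x p

/-- The set of relaxed projectors `(1 - μ) Id + μ P_C` with `C ∈ 𝒞` and `μ ∈ Λ`. -/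
def relaxedProjectors (𝒞 : Set (Set X)) (Λ : Set ℝ) : Set (X → X) :=
  {R | ∃ C ∈ 𝒞, ∃ μ ∈ Λ, R = fun x => (1 - μ) • x + μ • projector C x}

theorem IsPolyhedral.isClosed {C : Set X} (h : IsPolyhedral C) : IsClosed C := by
  obtain ⟨S, -, hS, rfl⟩ := h
  refine isClosed_sInter fun H hH => ?_
  obtain ⟨a, -, β, rfl⟩ := hS H hH
  exact isClosed_le (by fun_prop) continuous_const

theorem IsPolyhedral.convex {C : Set X} (h : IsPolyhedral C) : Convex ℝ C := by
  obtain ⟨S, -, hS, rfl⟩ := h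
  refine convex_sInter fun H hH => ?_
  obtain ⟨a, -, β, rfl⟩ := hS H hH
  exact convex_halfSpace_le (innerₗ X a).isLinear β

theorem isNearestPoint_iff_inner {C : Set X} (hc : Convex ℝ C) {x p : X} :
    IsNearestPoint C x p ↔ p ∈ C ∧ ∀ w ∈ C, inner ℝ (x - p) (w - p) ≤ 0 := by
  refine and_congr_right fun hp => ?_
  rw [← norm_eq_iInf_iff_real_inner_le_zero hc hp]
  have : Nonempty C := ⟨⟨p, hp⟩⟩
  have hb : BddBelow (Set.range fun w : C => ‖x - w‖) :=
    ⟨0, Set.forall_mem_range.2 fun _ => norm_nonneg _⟩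
  constructor
  · intro h
    exact le_antisymm (le_ciInf fun w => h w w.2) (ciInf_le hb ⟨p, hp⟩)
  · intro h y hy
    rw [h]
    exact ciInf_le hb ⟨y, hy⟩

theorem existsUnique_isNearestPoint [CompleteSpace X] {C : Set X} (hne : C.Nonempty)
    (hcl : IsClosed C) (hc : Convex ℝ C) (x : X) : ∃! p, IsNearestPoint C x p := by
  obtain ⟨p, hp, h⟩ := exists_norm_eq_iInf_of_complete_convex hne hcl.isComplete hc x
  refine ⟨p, (isNearestPoint_iff_inner hc).2
    ⟨hp, (norm_eq_iInf_iff_real_inner_le_zero hc hp).1 h⟩, fun q hq => ?_⟩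
  have h1 := (norm_eq_iInf_iff_real_inner_le_zero hc hp).1 h q hq.1
  have h2 := ((isNearestPoint_iff_inner hc).1 hq).2 p hp
  have h3 : inner ℝ (q - p) (q - p) ≤ 0 := by
    have e : inner ℝ (q - p) (q - p) = inner ℝ (x - p) (q - p) + inner ℝ (x - q) (p - q) := by
      rw [← neg_sub q p, inner_neg_right, ← sub_eq_add_neg, ← inner_sub_left]
      congr 1
      abel
    linarith
  rw [real_inner_self_eq_norm_sq] at h3
  exact sub_eq_zero.1 (norm_eq_zero.1 (pow_eq_zero_iff two_ne_zero |>.1 (le_antisymm h3 (sq_nonneg _))))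

theorem projector_eq_iff [CompleteSpace X] {C : Set X} (hne : C.Nonempty)
    (hcl : IsClosed C) (hc : Convex ℝ C) (x p : X) :
    projector C x = p ↔ IsNearestPoint C x p := by
  have hu := existsUnique_isNearestPoint hne hcl hc x
  have hs : IsNearestPoint C x (projector C x) := Classical.epsilon_spec hu.exists
  exact ⟨fun h => h ▸ hs, fun h => hu.unique hs h⟩

end RelaxedProjections

/-!
The nearest-point map of a polyhedron agrees at each point with the projection onto one of finitely
many affine subspaces of finite codimension, cut out by the constraints active at the nearest point.
So it suffices to bound the orbits of relaxed projections onto finitely many affine subspaces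
`q i + (W i)ᗮ` with `W i` finite-dimensional, by induction on their number. As relaxed projections
are nonexpansive, the orbits of the origin suffice, and these stay in the span of the `W i`.

Far out in a direction `u` of this span, the steps with `W i ⟂ u` commute with translations along
`u`, and their orbits are bounded by induction, since not all `W i` are orthogonal to `u`. Every
other step decreases both the norm and the component along `u` by a definite multiple of its length,
so the total length of these steps is bounded during an excursion above the initial norm.
Compactness of the unit sphere makes this uniform in `u`.
-/

namespace RelaxedProjections

open Filter Topology Relation

/-- The point `y` is reached from `x` by steps of `r` along which the height `f` stays above its
initial value `f x`. -/
abbrev IsExcursion {α : Type*} (r : α → α → Prop) (f : α → ℝ) (x y : α) : Prop :=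
  ReflTransGen (fun p p' => r p p' ∧ f x < f p') x y

theorem exists_le_of_isExcursion_le {α : Type*} {r : α → α → Prop} {f : α → ℝ} {x₀ : α}
    {R B D : ℝ} (hstep : ∀ x y, r x y → f y ≤ f x + D)
    (hexc : ∀ x y, ReflTransGen r x₀ x → R ≤ f x → IsExcursion r f x y → f y ≤ f x + B) :
    ∃ K, ∀ y, ReflTransGen r x₀ y → f y ≤ K := by
  set L := max (f x₀) (R + D)
  have last_restart : ∀ y, ReflTransGen r x₀ y → ∃ z, ReflTransGen r x₀ z ∧ f z ≤ L ∧
      IsExcursion r f z y ∧ (R ≤ f z ∨ y = z) := by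
    intro y hy
    induction hy with
    | refl => exact ⟨x₀, .refl, le_max_left _ _, .refl, .inr rfl⟩
    | @tail y y' hy hyy' ih =>
      obtain ⟨z, hz, hzL, hzy, hzR⟩ := ih
      have restart (h : f y' ≤ L) : ∃ z, ReflTransGen r x₀ z ∧ f z ≤ L ∧
          IsExcursion r f z y' ∧ (R ≤ f z ∨ y' = z) :=
        ⟨y', hy.tail hyy', h, .refl, .inr rfl⟩
      rcases le_or_gt R (f z) with hR | hR
      · rcases lt_or_ge (f z) (f y') with hlt | hge
        · exact ⟨z, hz, hzL, hzy.tail ⟨hyy', hlt⟩, .inl hR⟩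
        · exact restart (hge.trans hzL)
      · obtain rfl : y = z := hzR.resolve_left hR.not_ge
        exact restart (((hstep y y' hyy').trans (by gcongr)).trans (le_max_right _ _))
  refine ⟨L + max B 0, fun y hy => ?_⟩
  obtain ⟨z, hz, hzL, hzy, hR | rfl⟩ := last_restart y hy
  · exact (hexc z y hz hR hzy).trans (add_le_add hzL (le_max_left _ _))
  · exact hzL.trans (le_add_of_nonneg_right (le_max_right _ _))

variable {X : Type*} [NormedAddCommGroup X] [InnerProductSpace ℝ X]

section Projection

variable (W : Submodule ℝ X) [W.HasOrthogonalProjection]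

theorem inner_self_starProjection (x : X) :
    inner ℝ x (W.starProjection x) = ‖W.starProjection x‖ ^ 2 := by
  rw [real_inner_comm]
  exact W.re_inner_starProjection_eq_normSq x

theorem norm_sub_smul_starProjection_le {μ : ℝ} (hμ : μ ∈ Set.Icc 0 2) (x : X) :
    ‖x - μ • W.starProjection x‖ ≤ ‖x‖ := by
  refine (sq_le_sq₀ (norm_nonneg _) (norm_nonneg _)).1 ?_
  rw [norm_sub_sq_real, inner_smul_right, inner_self_starProjection, norm_smul,
    Real.norm_of_nonneg hμ.1]
  linarith [mul_nonneg (mul_nonneg hμ.1 (sub_nonneg.2 hμ.2)) (sq_nonneg ‖W.starProjection x‖)]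

theorem norm_step_sub_step_le {μ : ℝ} (hμ : μ ∈ Set.Icc 0 2) (q x y : X) :
    ‖x - μ • W.starProjection (x - q) - (y - μ • W.starProjection (y - q))‖ ≤ ‖x - y‖ := by
  have hdiff : x - μ • W.starProjection (x - q) - (y - μ • W.starProjection (y - q)) =
      (x - y) - μ • W.starProjection (x - y) := by
    simp only [map_sub]
    module
  rw [hdiff]
  exact norm_sub_smul_starProjection_le W hμ (x - y)

theorem norm_sq_sub_smul_starProjection_le {μ lam : ℝ} (hμ : μ ∈ Set.Icc 0 lam) (q x : X) :
    ‖x - μ • W.starProjection (x - q)‖ ^ 2 ≤ ‖x‖ ^ 2 -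
      μ * ‖W.starProjection (x - q)‖ * ((2 - lam) * ‖W.starProjection (x - q)‖ - 2 * ‖q‖) := by
  have hinner : inner ℝ x (W.starProjection (x - q)) =
      ‖W.starProjection (x - q)‖ ^ 2 + inner ℝ q (W.starProjection (x - q)) := by
    rw [← inner_self_starProjection, ← inner_add_left, sub_add_cancel]
  set g := W.starProjection (x - q)
  have hq : -(‖q‖ * ‖g‖) ≤ inner ℝ q g := neg_le_of_abs_le (abs_real_inner_le_norm q g)
  rw [norm_sub_sq_real, inner_smul_right, hinner, norm_smul, Real.norm_of_nonneg hμ.1]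
  linarith [mul_le_mul_of_nonneg_left hq hμ.1,
    mul_nonneg (mul_nonneg hμ.1 (sub_nonneg.2 hμ.2)) (sq_nonneg ‖g‖)]

theorem le_inner_starProjection {u : X} (hu : ‖u‖ = 1) (R : ℝ) (q y : X) :
    R * ‖W.starProjection u‖ ^ 2 - ‖y - R • u‖ - ‖q‖ ≤
      inner ℝ u (W.starProjection (y - q)) := by
  have hsplit : W.starProjection (y - q) =
      R • W.starProjection u + W.starProjection (y - R • u - q) := by
    rw [← map_smul, ← map_add]
    congr 1
    abel
  have herr : -‖y - R • u - q‖ ≤ inner ℝ u (W.starProjection (y - R • u - q)) := by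
    refine neg_le_of_abs_le ((abs_real_inner_le_norm _ _).trans ?_)
    rw [hu, one_mul]
    exact W.norm_starProjection_apply_le _
  rw [hsplit, inner_add_right, inner_smul_right, inner_self_starProjection]
  linarith [norm_sub_le (y - R • u) q]

theorem exists_starProjection_ne_zero_of_mem_sup {ι : Type*} {W : ι → Submodule ℝ X}
    [∀ i, (W i).HasOrthogonalProjection] {s : Finset ι} {u : X} (hu : u ∈ s.sup W) (hu0 : u ≠ 0) :
    ∃ i ∈ s, (W i).starProjection u ≠ 0 := by
  by_contra! h
  have hle : s.sup W ≤ (ℝ ∙ u)ᗮ := Finset.sup_le fun i hi => by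
    rw [Submodule.le_orthogonal_iff_le_orthogonal, Submodule.span_singleton_le_iff_mem,
      ← Submodule.starProjection_apply_eq_zero_iff]
    exact h i hi
  exact hu0 (inner_self_eq_zero.1 (Submodule.mem_orthogonal_singleton_iff_inner_right.1 (hle hu)))

end Projection

section AffineSteps

variable {ι : Type*} (W : ι → Submodule ℝ X) [∀ i, (W i).HasOrthogonalProjection] (q : ι → X)
  (lam : ℝ)

/-- One relaxed projection step, with relaxation parameter in `[0, lam]`, onto one of the affine
subspaces `q i + (W i)ᗮ` with `i ∈ s`. -/
def AffineStep (s : Finset ι) (x y : X) : Prop :=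
  ∃ i ∈ s, ∃ μ ∈ Set.Icc 0 lam, y = x - μ • (W i).starProjection (x - q i)

/-- The points that can be reached from `x` by a sequence of relaxed projection steps. -/
abbrev Reachable (s : Finset ι) : X → X → Prop :=
  ReflTransGen (AffineStep W q lam s)

open Classical in
/-- The indices in `s` of the affine subspaces `q i + (W i)ᗮ` that are parallel to `u`. -/
noncomputable def parallelIndices (s : Finset ι) (u : X) : Finset ι :=
  {i ∈ s | (W i).starProjection u = 0}

variable {W q lam} {s : Finset ι}

theorem mem_parallelIndices {u : X} {i : ι} :
    i ∈ parallelIndices W s u ↔ i ∈ s ∧ (W i).starProjection u = 0 := by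
  simp only [parallelIndices, Finset.mem_filter]

theorem parallelIndices_ssubset {u : X} (hu : u ∈ s.sup W) (hu0 : u ≠ 0) :
    parallelIndices W s u ⊂ s := by
  classical
  obtain ⟨i, his, hi⟩ := exists_starProjection_ne_zero_of_mem_sup hu hu0
  exact Finset.filter_ssubset.2 ⟨i, his, hi⟩

theorem AffineStep.norm_le (hlam : lam ≤ 2) {x y : X} (h : AffineStep W q lam s x y) :
    ‖y‖ ≤ ‖x‖ + 2 * ∑ i ∈ s, ‖q i‖ := by
  obtain ⟨i, hi, μ, hμ, rfl⟩ := h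
  have hqi : ‖q i‖ ≤ ∑ i ∈ s, ‖q i‖ :=
    Finset.single_le_sum (f := fun i => ‖q i‖) (fun _ _ => norm_nonneg _) hi
  calc ‖x - μ • (W i).starProjection (x - q i)‖
      = ‖((x - q i) - μ • (W i).starProjection (x - q i)) + q i‖ := by congr 1; abel
    _ ≤ ‖x - q i‖ + ‖q i‖ := (norm_add_le _ _).trans <| by
        gcongr
        exact norm_sub_smul_starProjection_le _ ⟨hμ.1, hμ.2.trans hlam⟩ _
    _ ≤ ‖x‖ + 2 * ∑ i ∈ s, ‖q i‖ := by linarith [norm_sub_le x (q i)]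

theorem AffineStep.mem_sup {x y : X} (h : AffineStep W q lam s x y) (hx : x ∈ s.sup W) :
    y ∈ s.sup W := by
  obtain ⟨i, hi, μ, -, rfl⟩ := h
  exact sub_mem hx (Submodule.smul_mem _ μ
    (Finset.le_sup (f := W) hi ((W i).starProjection_apply_mem _)))

theorem Reachable.mem_sup {y : X} (h : Reachable W q lam s 0 y) : y ∈ s.sup W := by
  induction h with
  | refl => exact zero_mem _
  | tail _ hstep ih => exact hstep.mem_sup ih

theorem Reachable.exists_norm_sub_le (hlam : lam ≤ 2) {x y : X} (h : Reachable W q lam s x y)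
    (x' : X) : ∃ y', Reachable W q lam s x' y' ∧ ‖y - y'‖ ≤ ‖x - x'‖ := by
  induction h with
  | refl => exact ⟨x', .refl, le_rfl⟩
  | @tail y z _ hyz ih =>
    obtain ⟨y', hy', hle⟩ := ih
    obtain ⟨i, hi, μ, hμ, rfl⟩ := hyz
    refine ⟨_, hy'.tail ⟨i, hi, μ, hμ, rfl⟩, le_trans ?_ hle⟩
    exact norm_step_sub_step_le _ ⟨hμ.1, hμ.2.trans hlam⟩ _ _ _

theorem Reachable.norm_le (hlam : lam ≤ 2) {K : ℝ} (hK : ∀ z, Reachable W q lam s 0 z → ‖z‖ ≤ K)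
    {x y : X} (h : Reachable W q lam s x y) : ‖y‖ ≤ ‖x‖ + K := by
  obtain ⟨y', hy', hle⟩ := h.exists_norm_sub_le hlam 0
  rw [sub_zero] at hle
  linarith [norm_le_norm_sub_add y y', hK y' hy']

theorem Reachable.sub_smul {u : X} (hu : ∀ i ∈ s, (W i).starProjection u = 0) {x y : X}
    (h : Reachable W q lam s x y) (c : ℝ) : Reachable W q lam s (x - c • u) (y - c • u) := by
  refine ReflTransGen.lift (· - c • u) ?_ _ _ h
  rintro x _ ⟨i, hi, μ, hμ, rfl⟩
  refine ⟨i, hi, μ, hμ, ?_⟩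
  simp only [map_sub, map_smul, hu i hi]
  module

theorem Reachable.norm_sub_smul_le (hlam : lam ≤ 2) {u : X} {K : ℝ}
    (hK : ∀ z, Reachable W q lam (parallelIndices W s u) 0 z → ‖z‖ ≤ K) {x y : X}
    (h : Reachable W q lam (parallelIndices W s u) x y) (c : ℝ) :
    ‖y - c • u‖ ≤ ‖x - c • u‖ + K :=
  Reachable.norm_le hlam hK (h.sub_smul (fun _ hi => (mem_parallelIndices.1 hi).2) c)

section Cone

variable (W lam s) in
/-- Quantitative transversality: `u` makes an angle with each of the subspaces `(W i)ᗮ`, `i ∈ s`,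
not containing it, that is large compared to the aperture `ε` of a cone around `u`. -/
structure IsTransversalAperture (u : X) (ε : ℝ) : Prop where
  pos : 0 < ε
  le_third : ε ≤ 1 / 3
  le_norm_sq : ∀ i ∈ s, (W i).starProjection u ≠ 0 → 8 * ε ≤ ‖(W i).starProjection u‖ ^ 2
  le_mul_norm_sq : ∀ i ∈ s, (W i).starProjection u ≠ 0 →
    8 * ε ≤ (2 - lam) * ‖(W i).starProjection u‖ ^ 2

theorem exists_isTransversalAperture (hlam : lam < 2) (u : X) :
    ∃ ε, IsTransversalAperture W lam s u ε := by
  have small {c : ℝ} (hc : 0 < c) : ∀ᶠ ε in 𝓝[>] (0 : ℝ), 8 * ε ≤ c := by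
    filter_upwards [nhdsWithin_le_nhds (eventually_le_nhds (show 0 < c / 8 by positivity))]
      with ε hε
    linarith
  have small_of_ne (c : ℝ) (hc : 0 < c) : ∀ᶠ ε in 𝓝[>] (0 : ℝ), ∀ i ∈ s,
      (W i).starProjection u ≠ 0 → 8 * ε ≤ c * ‖(W i).starProjection u‖ ^ 2 := by
    simp only [eventually_all_finset, eventually_imp_distrib_left]
    exact fun i _ hi => small (mul_pos hc (by positivity))
  obtain ⟨ε, hpos, hthird, hone, hrelax⟩ := (eventually_mem_nhdsWithin.and
    ((small (c := 8 / 3) (by norm_num)).and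
      ((small_of_ne 1 one_pos).and (small_of_ne (2 - lam) (sub_pos.2 hlam))))).exists
  exact ⟨ε, hpos, by linarith, by simpa only [one_mul] using hone, hrelax⟩

variable {u : X} {ε R : ℝ} {i : ι} {y : X}

theorem IsTransversalAperture.two_mul_norm_le_inner (hε : IsTransversalAperture W lam s u ε)
    (hu : ‖u‖ = 1) (hi : i ∈ s) (hiu : (W i).starProjection u ≠ 0) (hR : 0 ≤ R)
    (hq : ‖q i‖ ≤ ε * R) (hy : ‖y - R • u‖ ≤ 2 * (ε * R)) :
    2 * ε * ‖(W i).starProjection (y - q i)‖ ≤ inner ℝ u ((W i).starProjection (y - q i)) := by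
  have hlower : 5 * (ε * R) ≤ inner ℝ u ((W i).starProjection (y - q i)) := by
    linarith [le_inner_starProjection (W i) hu R (q i) y,
      mul_le_mul_of_nonneg_left (hε.le_norm_sq i hi hiu) hR]
  have hupper : ‖(W i).starProjection (y - q i)‖ ≤ 2 * R := by
    have hRu : ‖R • u‖ = R := by rw [norm_smul, hu, mul_one, Real.norm_of_nonneg hR]
    linarith [(W i).norm_starProjection_apply_le (y - q i), norm_sub_le y (q i),
      norm_le_norm_sub_add y (R • u), mul_le_mul_of_nonneg_right hε.le_third hR]
  linarith [mul_le_mul_of_nonneg_left hupper hε.pos.le, mul_nonneg hε.pos.le hR]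

theorem IsTransversalAperture.norm_sq_step_le (hε : IsTransversalAperture W lam s u ε)
    (hlam : lam < 2) (hu : ‖u‖ = 1) (hi : i ∈ s) (hiu : (W i).starProjection u ≠ 0) (hR : 0 ≤ R)
    (hq : ‖q i‖ ≤ ε * R) (hy : ‖y - R • u‖ ≤ 2 * (ε * R)) {μ : ℝ} (hμ : μ ∈ Set.Icc 0 lam) :
    ‖y - μ • (W i).starProjection (y - q i)‖ ^ 2 ≤
      ‖y‖ ^ 2 - 2 * (ε * R) * (μ * ‖(W i).starProjection (y - q i)‖) := by
  have hstep := norm_sq_sub_smul_starProjection_le (W i) hμ (q i) y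
  have hlower : 5 / 8 * (R * ‖(W i).starProjection u‖ ^ 2) ≤
      ‖(W i).starProjection (y - q i)‖ := by
    have hcauchy := real_inner_le_norm u ((W i).starProjection (y - q i))
    rw [hu, one_mul] at hcauchy
    linarith [le_inner_starProjection (W i) hu R (q i) y,
      mul_le_mul_of_nonneg_left (hε.le_norm_sq i hi hiu) hR]
  set g := (W i).starProjection (y - q i)
  have hgain : 2 * (ε * R) ≤ (2 - lam) * ‖g‖ - 2 * ‖q i‖ := by
    linarith [mul_le_mul_of_nonneg_left hlower (sub_pos.2 hlam).le,
      mul_le_mul_of_nonneg_left (hε.le_mul_norm_sq i hi hiu) hR, mul_nonneg hε.pos.le hR]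
  linarith [mul_le_mul_of_nonneg_left hgain (mul_nonneg hμ.1 (norm_nonneg g))]

end Cone

section Shadow

variable (W q lam s) in
/-- `y` is shadowed by an orbit from `x` of the steps parallel to `u`: the two differ by at most
`M`, while the component of `y` along `u` has dropped by at least `2 * ε * M`. During an excursion,
`M` is the total length of the steps not parallel to `u`. -/
def IsShadowed (u : X) (ε : ℝ) (x y : X) (M : ℝ) : Prop :=
  ∃ y', Reachable W q lam (parallelIndices W s u) x y' ∧ ‖y - y'‖ ≤ M ∧
    inner ℝ u y ≤ inner ℝ u x - 2 * ε * M

variable {u : X} {ε : ℝ} {x y : X} {M K : ℝ}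

theorem IsShadowed.refl : IsShadowed W q lam s u ε x x 0 :=
  ⟨x, .refl, by simp, by simp⟩

theorem IsShadowed.nonneg (h : IsShadowed W q lam s u ε x y M) : 0 ≤ M :=
  let ⟨_, _, hM, _⟩ := h
  (norm_nonneg _).trans hM

theorem IsShadowed.step_of_mem_parallelIndices (hlam : lam ≤ 2)
    (h : IsShadowed W q lam s u ε x y M) {i : ι} (hi : i ∈ parallelIndices W s u) {μ : ℝ}
    (hμ : μ ∈ Set.Icc 0 lam) :
    IsShadowed W q lam s u ε x (y - μ • (W i).starProjection (y - q i)) M := by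
  obtain ⟨y', hy', hM, hinner⟩ := h
  refine ⟨_, hy'.tail ⟨i, hi, μ, hμ, rfl⟩, le_trans ?_ hM, ?_⟩
  · exact norm_step_sub_step_le _ ⟨hμ.1, hμ.2.trans hlam⟩ _ _ _
  · have horth : inner ℝ u ((W i).starProjection (y - q i)) = 0 := by
      rw [← Submodule.inner_starProjection_left_eq_right, (mem_parallelIndices.1 hi).2,
        inner_zero_left]
    rwa [inner_sub_right, inner_smul_right, horth, mul_zero, sub_zero]

theorem IsShadowed.sub_smul (h : IsShadowed W q lam s u ε x y M) {g : X} {μ : ℝ} (hμ : 0 ≤ μ)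
    (hg : 2 * ε * ‖g‖ ≤ inner ℝ u g) :
    IsShadowed W q lam s u ε x (y - μ • g) (M + μ * ‖g‖) := by
  obtain ⟨y', hy', hM, hinner⟩ := h
  refine ⟨y', hy', ?_, ?_⟩
  · have hμg : ‖μ • g‖ = μ * ‖g‖ := by rw [norm_smul, Real.norm_of_nonneg hμ]
    rw [sub_right_comm]
    linarith [norm_sub_le (y - y') (μ • g)]
  · rw [inner_sub_right, inner_smul_right]
    linarith [mul_le_mul_of_nonneg_left hg hμ]

theorem IsShadowed.norm_sub_smul_le (hlam : lam ≤ 2)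
    (hK : ∀ z, Reachable W q lam (parallelIndices W s u) 0 z → ‖z‖ ≤ K)
    (h : IsShadowed W q lam s u ε x y M) (c : ℝ) : ‖y - c • u‖ ≤ ‖x - c • u‖ + (K + M) := by
  obtain ⟨y', hy', hM, -⟩ := h
  linarith [norm_sub_le_norm_sub_add_norm_sub y y' (c • u), hy'.norm_sub_smul_le hlam hK c]

theorem IsShadowed.norm_sq_le (hlam : lam ≤ 2) (hu : ‖u‖ = 1)
    (hK : ∀ z, Reachable W q lam (parallelIndices W s u) 0 z → ‖z‖ ≤ K)
    (hx : ‖x - ‖x‖ • u‖ ≤ ε * ‖x‖) (h : IsShadowed W q lam s u ε x y M) :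
    ‖y‖ ^ 2 ≤ ‖x‖ ^ 2 + 2 * (ε * ‖x‖) * (K - M) + (K + M) ^ 2 := by
  have hKM : 0 ≤ K + M := add_nonneg (by simpa using hK 0 .refl) h.nonneg
  have norm_sq_eq (z : X) :
      ‖z‖ ^ 2 = ‖z - ‖x‖ • u‖ ^ 2 + 2 * (‖x‖ * inner ℝ u z) - ‖x‖ ^ 2 := by
    rw [norm_sub_sq_real, inner_smul_right, real_inner_comm, norm_smul, hu, norm_norm]
    ring
  have hdist : ‖y - ‖x‖ • u‖ ^ 2 ≤ (‖x - ‖x‖ • u‖ + (K + M)) ^ 2 :=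
    pow_le_pow_left₀ (norm_nonneg _) (h.norm_sub_smul_le hlam hK _) 2
  obtain ⟨-, -, -, hinner⟩ := h
  linarith [norm_sq_eq x, norm_sq_eq y, mul_le_mul_of_nonneg_left hinner (norm_nonneg x),
    mul_le_mul_of_nonneg_right hx hKM]

/-- The total length of the steps not parallel to `u` stays below `K + 1`, because each of them
decreases the norm, which has to stay above `‖x‖`. -/
theorem IsExcursion.exists_isShadowed (hlam : lam < 2) (hu : ‖u‖ = 1)
    (hK : ∀ z, Reachable W q lam (parallelIndices W s u) 0 z → ‖z‖ ≤ K)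
    (hε : IsTransversalAperture W lam s u ε) (hx : ‖x - ‖x‖ • u‖ ≤ ε * ‖x‖)
    (hq : ∀ i ∈ s, ‖q i‖ ≤ ε * ‖x‖) (hKx : (2 * K + 1) ^ 2 ≤ ε * ‖x‖)
    (h : IsExcursion (AffineStep W q lam s) norm x y) :
    ∃ M ≤ K + 1, IsShadowed W q lam s u ε x y M := by
  have hK0 : 0 ≤ K := by simpa using hK 0 .refl
  induction h with
  | refl => exact ⟨0, by linarith, .refl⟩
  | @tail y y' _ hstep ih =>
    obtain ⟨M, hMK, hM⟩ := ih
    obtain ⟨⟨i, hi, μ, hμ, rfl⟩, habove⟩ := hstep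
    by_cases hiu : (W i).starProjection u = 0
    · exact ⟨M, hMK, hM.step_of_mem_parallelIndices hlam.le (mem_parallelIndices.2 ⟨hi, hiu⟩) hμ⟩
    have hnear : ‖y - ‖x‖ • u‖ ≤ 2 * (ε * ‖x‖) := by
      nlinarith [hM.norm_sub_smul_le hlam.le hK ‖x‖]
    have hdrop := hε.norm_sq_step_le hlam hu hi hiu (norm_nonneg x) (hq i hi) hnear hμ
    have hinner := hε.two_mul_norm_le_inner hu hi hiu (norm_nonneg x) (hq i hi) hnear
    set g := (W i).starProjection (y - q i)
    refine ⟨M + μ * ‖g‖, ?_, hM.sub_smul hμ.1 hinner⟩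
    have hεx : 0 < ε * ‖x‖ := by nlinarith
    have habove_sq : ‖x‖ ^ 2 < ‖y - μ • g‖ ^ 2 :=
      pow_lt_pow_left₀ habove (norm_nonneg x) two_ne_zero
    have hKM : (K + M) ^ 2 ≤ ε * ‖x‖ :=
      (pow_le_pow_left₀ (add_nonneg hK0 hM.nonneg) (by linarith) 2).trans hKx
    refine le_of_mul_le_mul_left ?_ hεx
    linarith [hM.norm_sq_le hlam.le hu hK hx]

theorem IsExcursion.norm_le (hlam : lam < 2) (hu : ‖u‖ = 1)
    (hK : ∀ z, Reachable W q lam (parallelIndices W s u) 0 z → ‖z‖ ≤ K)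
    (hε : IsTransversalAperture W lam s u ε) (hx : ‖x - ‖x‖ • u‖ ≤ ε * ‖x‖)
    (hq : ∀ i ∈ s, ‖q i‖ ≤ ε * ‖x‖) (hKx : (2 * K + 1) ^ 2 ≤ ε * ‖x‖)
    (h : IsExcursion (AffineStep W q lam s) norm x y) : ‖y‖ ≤ ‖x‖ + (K + 1) := by
  have hK0 : 0 ≤ K := by simpa using hK 0 .refl
  obtain ⟨M, hMK, hM⟩ := h.exists_isShadowed hlam hu hK hε hx hq hKx
  have hKM : (K + M) ^ 2 ≤ ε * ‖x‖ :=
    (pow_le_pow_left₀ (add_nonneg hK0 hM.nonneg) (by linarith) 2).trans hKx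
  have hεx : ε * ‖x‖ ≤ ‖x‖ :=
    mul_le_of_le_one_left (norm_nonneg x) (hε.le_third.trans (by norm_num))
  refine (sq_le_sq₀ (norm_nonneg _) (by positivity)).1 ?_
  calc ‖y‖ ^ 2 ≤ ‖x‖ ^ 2 + 2 * (ε * ‖x‖) * (K - M) + (K + M) ^ 2 :=
        hM.norm_sq_le hlam.le hu hK hx
    _ ≤ (‖x‖ + (K + 1)) ^ 2 := by
      nlinarith [mul_nonneg (hKM.trans' (sq_nonneg _)) hM.nonneg,
        mul_le_mul_of_nonneg_right hεx hK0, norm_nonneg x]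

end Shadow

section Compactness

variable (W q lam s) in
/-- The excursions that start far out in a direction belonging to `S` rise above the initial norm by
a bounded amount only. -/
def ExcursionsBoundedOn (S : Set X) : Prop :=
  ∃ R B : ℝ, ∀ x y : X, ‖x‖⁻¹ • x ∈ S → R ≤ ‖x‖ →
    IsExcursion (AffineStep W q lam s) norm x y → ‖y‖ ≤ ‖x‖ + B

theorem ExcursionsBoundedOn.mono {S T : Set X} (hST : S ⊆ T)
    (hT : ExcursionsBoundedOn W q lam s T) : ExcursionsBoundedOn W q lam s S :=
  let ⟨R, B, h⟩ := hT
  ⟨R, B, fun x y hx => h x y (hST hx)⟩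

theorem ExcursionsBoundedOn.union {S T : Set X} (hS : ExcursionsBoundedOn W q lam s S)
    (hT : ExcursionsBoundedOn W q lam s T) : ExcursionsBoundedOn W q lam s (S ∪ T) := by
  obtain ⟨R₁, B₁, h₁⟩ := hS
  obtain ⟨R₂, B₂, h₂⟩ := hT
  refine ⟨max R₁ R₂, max B₁ B₂, fun x y hx hR hxy => ?_⟩
  rcases hx with hx | hx
  · exact (h₁ x y hx ((le_max_left _ _).trans hR) hxy).trans (by gcongr; exact le_max_left _ _)
  · exact (h₂ x y hx ((le_max_right _ _).trans hR) hxy).trans (by gcongr; exact le_max_right _ _)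

theorem excursionsBoundedOn_ball (hlam : lam < 2) {u : X} (hu : ‖u‖ = 1) {K : ℝ}
    (hK : ∀ z, Reachable W q lam (parallelIndices W s u) 0 z → ‖z‖ ≤ K) :
    ∃ ε > 0, ExcursionsBoundedOn W q lam s (Metric.ball u ε) := by
  obtain ⟨ε, hε⟩ := exists_isTransversalAperture (W := W) (s := s) hlam u
  set Q := ∑ i ∈ s, ‖q i‖
  refine ⟨ε, hε.pos, max Q ((2 * K + 1) ^ 2) / ε, K + 1, fun x y hx hR hxy => ?_⟩
  rw [div_le_iff₀' hε.pos, max_le_iff] at hR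
  have hcone : ‖x - ‖x‖ • u‖ ≤ ε * ‖x‖ := by
    rcases eq_or_ne x 0 with rfl | hx0
    · simp
    calc ‖x - ‖x‖ • u‖ = ‖x‖ * ‖‖x‖⁻¹ • x - u‖ := by
          rw [← norm_norm x, ← norm_smul, norm_norm, smul_sub,
            smul_inv_smul₀ (norm_ne_zero_iff.2 hx0)]
      _ ≤ ε * ‖x‖ := by
          rw [mul_comm]
          gcongr
          exact (mem_ball_iff_norm.1 hx).le
  have hq : ∀ i ∈ s, ‖q i‖ ≤ ε * ‖x‖ := fun i hi =>
    (Finset.single_le_sum (f := fun i => ‖q i‖) (fun _ _ => norm_nonneg _) hi).trans hR.1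
  exact hxy.norm_le hlam hu hK hε hcone hq hR.2

theorem excursionsBoundedOn_of_isCompact {S : Set X} (hS : IsCompact S)
    (h : ∀ u ∈ S, ∃ ε > 0, ExcursionsBoundedOn W q lam s (Metric.ball u ε)) :
    ExcursionsBoundedOn W q lam s S := by
  refine hS.induction_on ⟨0, 0, by simp⟩ (fun _ _ => .mono) (fun _ _ => .union) fun u hu => ?_
  obtain ⟨ε, hε, hball⟩ := h u hu
  exact ⟨_, mem_nhdsWithin_of_mem_nhds (Metric.ball_mem_nhds u hε), hball⟩

end Compactness

end AffineSteps

theorem exists_norm_le_of_reachable_zero {ι : Type*} {W : ι → Submodule ℝ X}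
    [∀ i, FiniteDimensional ℝ (W i)] {lam : ℝ} (hlam : lam < 2) (q : ι → X) (s : Finset ι) :
    ∃ K, ∀ y, Reachable W q lam s 0 y → ‖y‖ ≤ K := by
  induction s using Finset.strongInduction with
  | H s ih =>
    set V := s.sup W
    have : FiniteDimensional ℝ V := Submodule.finiteDimensional_finset_sup s W
    have hsphere : IsCompact ((↑) '' Metric.sphere (0 : V) 1 : Set X) :=
      (isCompact_sphere _ _).image continuous_subtype_val
    obtain ⟨R, B, hRB⟩ : ExcursionsBoundedOn W q lam s ((↑) '' Metric.sphere (0 : V) 1) := by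
      refine excursionsBoundedOn_of_isCompact hsphere ?_
      rintro _ ⟨u, hu, rfl⟩
      have hu1 : ‖(u : X)‖ = 1 := by simpa using hu
      obtain ⟨K, hK⟩ := ih _ (parallelIndices_ssubset u.2 (norm_ne_zero_iff.1 (by simp [hu1])))
      exact excursionsBoundedOn_ball hlam hu1 hK
    refine exists_le_of_isExcursion_le (R := max R 1) (B := B)
      (fun x y hxy => hxy.norm_le hlam.le) fun x y hx hR hxy => ?_
    have hx0 : ‖x‖ ≠ 0 := (one_pos.trans_le ((le_max_right _ _).trans hR)).ne'
    refine hRB x y ⟨⟨‖x‖⁻¹ • x, V.smul_mem _ (Reachable.mem_sup hx)⟩, ?_, rfl⟩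
      ((le_max_left _ _).trans hR) hxy
    simp [norm_smul, hx0]

theorem exists_norm_le_of_reachable {ι : Type*} {W : ι → Submodule ℝ X}
    [∀ i, FiniteDimensional ℝ (W i)] {lam : ℝ} (hlam : lam < 2) (q : ι → X) (s : Finset ι) (x : X) :
    ∃ K, ∀ y, Reachable W q lam s x y → ‖y‖ ≤ K := by
  obtain ⟨K, hK⟩ := exists_norm_le_of_reachable_zero (W := W) hlam q s
  exact ⟨‖x‖ + K, fun y => Reachable.norm_le hlam.le hK⟩

section Polyhedral

/-- The polyhedron of the solutions of the system of inequalities `⟪a, z⟫ ≤ β`, `(a, β) ∈ S`. -/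
def polyhedron (S : Finset (X × ℝ)) : Set X :=
  {z | ∀ j ∈ S, inner ℝ j.1 z ≤ j.2}

/-- The span of the normals `a` of the constraints `(a, β) ∈ S`. -/
def normalSpan (S : Finset (X × ℝ)) : Submodule ℝ X :=
  Submodule.span ℝ (Prod.fst '' (S : Set (X × ℝ)))

/-- A point at which all constraints in `S` are active, that is, hold with equality. It is arbitrary
if there is none. -/
noncomputable def activePoint (S : Finset (X × ℝ)) : X :=
  Classical.epsilon fun z => ∀ j ∈ S, inner ℝ j.1 z = j.2

instance finiteDimensional_normalSpan (S : Finset (X × ℝ)) : FiniteDimensional ℝ (normalSpan S) :=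
  FiniteDimensional.span_of_finite ℝ (S.finite_toSet.image _)

variable {S : Finset (X × ℝ)} {x p v : X}

theorem mem_orthogonal_normalSpan : v ∈ (normalSpan S)ᗮ ↔ ∀ j ∈ S, inner ℝ j.1 v = 0 := by
  rw [← Submodule.span_singleton_le_iff_mem, ← Submodule.le_orthogonal_iff_le_orthogonal,
    normalSpan, Submodule.span_le, Set.image_subset_iff]
  exact forall₂_congr fun j _ => Submodule.mem_orthogonal_singleton_iff_inner_left

theorem IsPolyhedral.exists_eq_polyhedron {C : Set X} (hC : IsPolyhedral C) :
    ∃ S, C = polyhedron S := by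
  classical
  obtain ⟨𝓗, hfin, hhalf, rfl⟩ := hC
  choose! a _ β hH using hhalf
  refine ⟨hfin.toFinset.image fun H => (a H, β H), Set.ext fun z => ?_⟩
  simp only [polyhedron, Set.mem_sInter, Finset.forall_mem_image, Set.Finite.mem_toFinset,
    Set.mem_ofPred_eq]
  exact forall₂_congr fun H h => by rw [Set.ext_iff.1 (hH H h) z]; rfl

theorem convex_polyhedron (S : Finset (X × ℝ)) : Convex ℝ (polyhedron S) := by
  simp only [polyhedron, Set.ofPred_forall]
  exact convex_iInter₂ fun j _ => convex_halfSpace_le (innerₗ X j.1).isLinear j.2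

theorem exists_isNearestPoint_of_add_mem {N : Submodule ℝ X} [FiniteDimensional ℝ N] {C : Set X}
    (hcl : IsClosed C) (hne : C.Nonempty) (hN : ∀ z ∈ C, ∀ v ∈ Nᗮ, z + v ∈ C) (x : X) :
    ∃ p, IsNearestPoint C x p := by
  have hproj : ∀ z ∈ C, N.starProjection z ∈ C := fun z hz => by
    simpa using hN z hz _ (neg_mem (N.sub_starProjection_mem_orthogonal z))
  obtain ⟨z₀, hz₀⟩ := hne
  obtain ⟨p, hp, hdist⟩ := (hcl.preimage continuous_subtype_val).exists_infDist_eq_dist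
    ⟨N.orthogonalProjectionOnto z₀, hproj z₀ hz₀⟩ (N.orthogonalProjectionOnto x)
  refine ⟨p + (x - N.starProjection x), hN p hp _ (N.sub_starProjection_mem_orthogonal x),
    fun y hy => ?_⟩
  calc ‖x - (p + (x - N.starProjection x))‖ = ‖N.starProjection x - p‖ := by congr 1; abel
    _ ≤ ‖N.starProjection x - N.starProjection y‖ := by
      have h := Metric.infDist_le_dist_of_mem (x := N.orthogonalProjectionOnto x)
        (show N.orthogonalProjectionOnto y ∈ Subtype.val ⁻¹' C from hproj y hy)
      rw [hdist, dist_eq_norm, dist_eq_norm] at h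
      exact h
    _ ≤ ‖x - y‖ := by
      rw [← map_sub]
      exact N.norm_starProjection_apply_le _

theorem IsPolyhedral.isNearestPoint_projector {C : Set X} (hC : IsPolyhedral C) (hne : C.Nonempty)
    (x : X) : IsNearestPoint C x (projector C x) := by
  have hcl := hC.isClosed
  obtain ⟨S, rfl⟩ := hC.exists_eq_polyhedron
  refine Classical.epsilon_spec
    (exists_isNearestPoint_of_add_mem (N := normalSpan S) hcl hne (fun z hz v hv j hj => ?_) x)
  rw [inner_add_right, mem_orthogonal_normalSpan.1 hv j hj, add_zero]
  exact hz j hj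

theorem eventually_add_smul_mem_polyhedron (hp : p ∈ polyhedron S)
    (hv : ∀ j ∈ S, inner ℝ j.1 p = j.2 → inner ℝ j.1 v = 0) :
    ∀ᶠ t : ℝ in 𝓝 0, p + t • v ∈ polyhedron S := by
  simp only [polyhedron, Set.mem_ofPred_eq]
  rw [eventually_all_finset]
  intro j hj
  rcases (hp j hj).eq_or_lt with hactive | hslack
  · refine .of_forall fun t => ?_
    rw [inner_add_right, inner_smul_right, hv j hj hactive, mul_zero, add_zero, hactive]
  · have hcont : ContinuousAt (fun t : ℝ => inner ℝ j.1 (p + t • v)) 0 := by fun_prop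
    exact hcont.eventually_le_const (by simpa using hslack)

theorem IsNearestPoint.sub_mem_normalSpan {T : Finset (X × ℝ)}
    (h : IsNearestPoint (polyhedron S) x p) (hT : ∀ j ∈ S, inner ℝ j.1 p = j.2 → j ∈ T) :
    x - p ∈ normalSpan T := by
  obtain ⟨hp, hinner⟩ := (isNearestPoint_iff_inner (convex_polyhedron S)).1 h
  have hle : ∀ v ∈ (normalSpan T)ᗮ, inner ℝ (x - p) v ≤ 0 := by
    intro v hv
    have hmem := eventually_add_smul_mem_polyhedron hp fun j hj hactive =>
      mem_orthogonal_normalSpan.1 hv j (hT j hj hactive)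
    obtain ⟨t, ht, ht0⟩ := ((hmem.filter_mono nhdsWithin_le_nhds).and
      (eventually_mem_nhdsWithin (s := Set.Ioi 0))).exists
    have := hinner _ ht
    rw [add_sub_cancel_left, inner_smul_right] at this
    exact nonpos_of_mul_nonpos_right this ht0
  rw [← Submodule.orthogonal_orthogonal (normalSpan T), Submodule.mem_orthogonal']
  refine fun v hv => (hle v hv).antisymm ?_
  simpa using hle (-v) (neg_mem hv)

theorem IsNearestPoint.exists_sub_eq_starProjection (h : IsNearestPoint (polyhedron S) x p) :
    ∃ T ⊆ S, x - p = (normalSpan T).starProjection (x - activePoint T) := by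
  classical
  set T := S.filter fun j => inner ℝ j.1 p = j.2
  have hactive : ∀ j ∈ T, inner ℝ j.1 p = j.2 := fun j hj => (Finset.mem_filter.1 hj).2
  have hq : ∀ j ∈ T, inner ℝ j.1 (activePoint T) = j.2 :=
    Classical.epsilon_spec (p := fun z => ∀ j ∈ T, inner ℝ j.1 z = j.2) ⟨p, hactive⟩
  refine ⟨T, Finset.filter_subset _ _, (Submodule.eq_starProjection_of_mem_orthogonal'
    (h.sub_mem_normalSpan fun j hj hj' => Finset.mem_filter.2 ⟨hj, hj'⟩)
    (mem_orthogonal_normalSpan.2 fun j hj => ?_) (sub_add_sub_cancel x p _).symm).symm⟩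
  rw [inner_sub_right, hactive j hj, hq j hj, sub_self]

theorem exists_finset_affineStep {𝒞 : Set (Set X)} (hfin : 𝒞.Finite)
    (h𝒞 : ∀ C ∈ 𝒞, C.Nonempty ∧ IsPolyhedral C) (lam : ℝ) :
    ∃ s : Finset (Finset (X × ℝ)), ∀ R ∈ relaxedProjectors 𝒞 (Set.Icc 0 lam), ∀ x,
      AffineStep normalSpan activePoint lam s x (R x) := by
  classical
  choose! S hS using fun C hC => (h𝒞 C hC).2.exists_eq_polyhedron
  refine ⟨hfin.toFinset.biUnion fun C => (S C).powerset, ?_⟩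
  rintro _ ⟨C, hC, μ, hμ, rfl⟩ x
  have hp := (h𝒞 C hC).2.isNearestPoint_projector (h𝒞 C hC).1 x
  set p := projector C x
  rw [hS C hC] at hp
  obtain ⟨T, hTS, hT⟩ := hp.exists_sub_eq_starProjection
  refine ⟨T, Finset.mem_biUnion.2 ⟨C, hfin.mem_toFinset.2 hC, Finset.mem_powerset.2 hTS⟩, μ, hμ, ?_⟩
  rw [← hT]
  module

end Polyhedral

end RelaxedProjections

open RelaxedProjections in
theorem theorem3p2_general {X : Type*} [NormedAddCommGroup X] [InnerProductSpace ℝ X]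
    (𝒞 : Set (Set X)) (h𝒞_finite : 𝒞.Finite) (h𝒞 : ∀ C ∈ 𝒞, C.Nonempty ∧ IsPolyhedral C)
    (lam : ℝ) (hlam : lam < 2) (x : ℕ → X)
    (hx_succ : ∀ n : ℕ, ∃ R ∈ relaxedProjectors 𝒞 (Set.Icc 0 lam), x (n + 1) = R (x n)) :
    Bornology.IsBounded (Set.range x) := by
  obtain ⟨s, hs⟩ := exists_finset_affineStep h𝒞_finite h𝒞 lam
  have hreach : ∀ n, Reachable normalSpan activePoint lam s (x 0) (x n) := by
    intro n
    induction n with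
    | zero => exact .refl
    | succ n ih =>
      obtain ⟨R, hR, hxR⟩ := hx_succ n
      exact ih.tail (hxR ▸ hs R hR (x n))
  obtain ⟨K, hK⟩ := exists_norm_le_of_reachable (W := normalSpan) hlam activePoint s (x 0)
  exact isBounded_iff_forall_norm_le.2 ⟨K, Set.forall_mem_range.2 fun n => hK _ (hreach n)⟩

theorem theorem3p2 {X : Type*} [NormedAddCommGroup X] [InnerProductSpace ℝ X] [CompleteSpace X]
    (𝒞 : Set (Set X)) (h𝒞_finite : 𝒞.Finite) (h𝒞_nonempty : 𝒞.Nonempty)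
    (h𝒞 : ∀ C ∈ 𝒞, C.Nonempty ∧ RelaxedProjections.IsPolyhedral C)
    (lam : ℝ) (hlam : lam ∈ Set.Ico (0 : ℝ) 2) (x₀ : X)
    (x : ℕ → X) (hx_zero : x 0 = x₀)
    (hx_succ : ∀ n : ℕ, ∃ R ∈ RelaxedProjections.relaxedProjectors 𝒞 (Set.Icc 0 lam),
      x (n + 1) = R (x n)) :
    Bornology.IsBounded (Set.range x) := by
  exact theorem3p2_general 𝒞 h𝒞_finite h𝒞 lam hlam.2 x hx_succ
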